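/- Let $p$ be a probability distribution on an input space $U$, let $X_1,\dots,X_K:U\to\mathbb R$ be readout functions and $y:U\to\mathbb R$ a target function, all with finite sixth moments under $p$, and write $E[f]=\int f\,dp$. Assume $E[y^2]>0$ and that the Gram matrix $G_{ij}=E[X_iX_j]$ has full rank. Let $\Lambda$ be any $K\times K$ matrix with $\Lambda^\top G\Lambda=\mathbb I$, and put $\tilde X_l=\sum_i X_i\Lambda_{il}$, so that $E[\tilde X_i\tilde X_j]=\delta_{ij}$. Assume that the capacity $$C(y,X)=1-\frac{\inf_{W\in\mathbb R^K}E\big[(\sum_iW_iX_i-y)^2\big]}{E[y^2]}$$ is $0$. Let $u(1),u(2),\dots$ be independent random inputs with distribution $p$, and let the empirical capacity on $N$ samples, with $E[y^2]$ known exactly, be $$C_N(y,X)=\frac{R_N^\top G_N^{-1}R_N}{E[y^2]},\qquad (R_N)_i=\frac1N\sum_{n=1}^N X_i(u(n))\,y(u(n)),\qquad (G_N)_{ij}=\frac1N\sum_{n=1}^N X_i(u(n))X_j(u(n)),$$ where $G_N^{-1}$ is the Moore–Penrose pseudo-inverse if $G_N$ is singular. Then for every $N$ the random variable $C_N(y,X)$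 is integrable, and as $N\to\infty$ (with $K$, $p$, $X$, $y$ fixed) its expectation over datasets satisfies $$E\big[C_N(y,X)\big]=\frac{\Delta(y,X)}{N}+\mathcal O\big(N^{-3/2}\big),$$ where $$\Delta(y,X)=\frac{E\big[\big(\sum_{i=1}^K\tilde X_i^2\big)y^2\big]}{E[y^2]}\le\frac{\sqrt{E\big[\big(\sum_{i=1}^K\tilde X_i^2\big)^2\big]\,E[y^4]}}{E[y^2]}.$$ -/

import Mathlib

open MeasureTheory ProbabilityTheory Filter Asymptotics Matrix

namespace StationarySystem

/-! ### Moore-Penrose pseudo-inverse of a square real matrix -/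

/-- `B` is the Moore-Penrose pseudo-inverse of the real square matrix `A`: the four Penrose
equations hold. -/
structure IsPseudoInverse {K : ℕ} (A B : Matrix (Fin K) (Fin K) ℝ) : Prop where
  mul_mul_self : A * B * A = A
  self_mul_mul : B * A * B = B
  left_symm : (A * B)ᵀ = A * B
  right_symm : (B * A)ᵀ = B * A

/-- The four Penrose equations have at most one solution. -/
theorem IsPseudoInverse.unique {K : ℕ} {A B C : Matrix (Fin K) (Fin K) ℝ}
    (hB : IsPseudoInverse A B) (hC : IsPseudoInverse A C) : B = C := by
  have h1 : A * B = A * C := by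
    calc A * B = (A * C * A) * B := by rw [hC.mul_mul_self]
      _ = (A * C)ᵀ * (A * B)ᵀ := by
        rw [hC.left_symm, hB.left_symm]; simp only [Matrix.mul_assoc]
      _ = (A * B * A * C)ᵀ := by
        rw [← Matrix.transpose_mul]; simp only [Matrix.mul_assoc]
      _ = A * C := by rw [hB.mul_mul_self, hC.left_symm]
  have h2 : B * A = C * A := by
    calc B * A = B * (A * C * A) := by rw [hC.mul_mul_self]
      _ = (B * A)ᵀ * (C * A)ᵀ := by
        rw [hC.right_symm, hB.right_symm]; simp only [Matrix.mul_assoc]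
      _ = (C * (A * B * A))ᵀ := by
        rw [← Matrix.transpose_mul]; simp only [Matrix.mul_assoc]
      _ = C * A := by rw [hB.mul_mul_self, hC.right_symm]
  calc B = B * A * B := hB.self_mul_mul.symm
    _ = C * A * C := by rw [h2, Matrix.mul_assoc, h1, Matrix.mul_assoc]
    _ = C := hC.self_mul_mul

/-- Every real symmetric matrix has a Moore-Penrose pseudo-inverse. -/
theorem exists_isPseudoInverse {K : ℕ} {A : Matrix (Fin K) (Fin K) ℝ} (hA : Aᵀ = A) :
    ∃ B, IsPseudoInverse A B := by
  have hH : A.IsHermitian := by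
    rw [Matrix.IsHermitian, Matrix.conjTranspose_eq_transpose_of_trivial, hA]
  obtain ⟨U, d, hU, hAd⟩ : ∃ (U : Matrix (Fin K) (Fin K) ℝ) (d : Fin K → ℝ),
      Uᵀ * U = 1 ∧ A = U * Matrix.diagonal d * Uᵀ := by
    refine ⟨hH.eigenvectorUnitary, hH.eigenvalues, ?_, ?_⟩
    · have := Unitary.coe_star_mul_self hH.eigenvectorUnitary
      rwa [Matrix.star_eq_conjTranspose, Matrix.conjTranspose_eq_transpose_of_trivial] at this
    · have := hH.spectral_theorem
      rw [Unitary.conjStarAlgAut_apply, Matrix.star_eq_conjTranspose,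
        Matrix.conjTranspose_eq_transpose_of_trivial] at this
      simpa using this
  have key : ∀ a b : Fin K → ℝ, (U * Matrix.diagonal a * Uᵀ) * (U * Matrix.diagonal b * Uᵀ)
      = U * Matrix.diagonal (fun i => a i * b i) * Uᵀ := by
    intro a b
    calc _ = U * Matrix.diagonal a * (Uᵀ * U) * Matrix.diagonal b * Uᵀ := by
          simp only [Matrix.mul_assoc]
      _ = _ := by
          rw [hU, Matrix.mul_one, Matrix.mul_assoc U, Matrix.diagonal_mul_diagonal]
  have hT : ∀ a : Fin K → ℝ, (U * Matrix.diagonal a * Uᵀ)ᵀ = U * Matrix.diagonal a * Uᵀ := by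
    intro a
    simp [Matrix.transpose_mul, Matrix.mul_assoc]
  refine ⟨U * Matrix.diagonal (fun i => (d i)⁻¹) * Uᵀ, ?_⟩
  subst hAd
  refine ⟨?_, ?_, ?_, ?_⟩
  · rw [key, key]; congr; funext i; exact mul_inv_mul_cancel (d i)
  · rw [key, key]; congr; funext i
    simpa using mul_inv_mul_cancel (d i)⁻¹
  · rw [key, hT]
  · rw [key, hT]

open Classical in
/-- The Moore-Penrose pseudo-inverse of a real square matrix. -/
noncomputable def pinv {K : ℕ} (A : Matrix (Fin K) (Fin K) ℝ) : Matrix (Fin K) (Fin K) ℝ :=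
  if h : ∃ B, IsPseudoInverse A B then h.choose else 0

/-- On symmetric matrices `pinv` satisfies the Penrose equations. -/
theorem isPseudoInverse_pinv {K : ℕ} {A : Matrix (Fin K) (Fin K) ℝ} (hA : Aᵀ = A) :
    IsPseudoInverse A (pinv A) := by
  have h := exists_isPseudoInverse hA
  rw [pinv, dif_pos h]
  exact h.choose_spec

/-- On invertible symmetric matrices `pinv` is the inverse. -/
theorem pinv_eq_inv {K : ℕ} {A : Matrix (Fin K) (Fin K) ℝ} (hA : Aᵀ = A)
    (hdet : IsUnit A.det) : pinv A = A⁻¹ := by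
  refine (isPseudoInverse_pinv hA).unique ⟨?_, ?_, ?_, ?_⟩ <;>
    simp [Matrix.mul_nonsing_inv _ hdet, Matrix.nonsing_inv_mul _ hdet]

/-! ### Population quantities

The inputs live in `U` and are distributed according to `p`; the readouts are the functions
`X 1, …, X K` and the target is `y`. -/

section Population

variable {U : Type*} [MeasurableSpace U]

/-- Gram matrix `G i j = E[X i * X j]`. -/
noncomputable def gram {K : ℕ} (p : Measure U) (X : Fin K → U → ℝ) :
    Matrix (Fin K) (Fin K) ℝ :=
  Matrix.of fun i j => ∫ v, X i v * X j v ∂p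

/-- Mean squared error of the linear output `∑ i, W i * X i`. -/
noncomputable def mse {K : ℕ} (p : Measure U) (X : Fin K → U → ℝ) (y : U → ℝ)
    (W : Fin K → ℝ) : ℝ :=
  ∫ v, ((∑ i, W i * X i v) - y v) ^ 2 ∂p

/-- Optimized mean squared error over all weights. -/
noncomputable def minMse {K : ℕ} (p : Measure U) (X : Fin K → U → ℝ) (y : U → ℝ) : ℝ :=
  ⨅ W : Fin K → ℝ, mse p X y W

/-- Capacity `C(y, X) = 1 - MSE* / E[y ^ 2]`. -/
noncomputable def capacity {K : ℕ} (p : Measure U) (X : Fin K → U → ℝ) (y : U → ℝ) : ℝ :=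
  1 - minMse p X y / ∫ v, y v ^ 2 ∂p

/-- Transformed readouts `X̃ l = ∑ i, X i * Λ i l`. -/
def transformed {K : ℕ} (X : Fin K → U → ℝ) (Λ : Matrix (Fin K) (Fin K) ℝ) (l : Fin K) (v : U) :
    ℝ :=
  ∑ i, X i v * Λ i l

/-- `Δ = E[(∑ i, X̃ i ^ 2) * y ^ 2] / E[y ^ 2]`, as a function of the readouts `Xt` (meant to be
orthonormal) and the target. -/
noncomputable def Delta {K : ℕ} (p : Measure U) (Xt : Fin K → U → ℝ) (y : U → ℝ) : ℝ :=
  (∫ v, (∑ i, Xt i v ^ 2) * y v ^ 2 ∂p) / ∫ v, y v ^ 2 ∂p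

end Population

/-! ### Empirical quantities, for a sequence of inputs `s 0, s 1, …` cut after `N` terms -/

section Empirical

variable {U : Type*}

/-- Empirical Gram matrix over the first `N` samples. -/
noncomputable def empGram {K : ℕ} (X : Fin K → U → ℝ) (s : ℕ → U) (N : ℕ) :
    Matrix (Fin K) (Fin K) ℝ :=
  Matrix.of fun i j => (1 / (N : ℝ)) * ∑ n ∈ Finset.range N, X i (s n) * X j (s n)

/-- Empirical correlation vector over the first `N` samples. -/
noncomputable def empCorr {K : ℕ} (X : Fin K → U → ℝ) (y : U → ℝ) (s : ℕ → U) (N : ℕ) :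
    Fin K → ℝ :=
  fun i => (1 / (N : ℝ)) * ∑ n ∈ Finset.range N, X i (s n) * y (s n)

/-- Empirical capacity `C_N(y, X) = R_Nᵀ G_N⁻¹ R_N / E[y ^ 2]` when `m = E[y ^ 2]` is known
exactly; the inverse is the pseudo-inverse where the empirical Gram matrix is singular. -/
noncomputable def empCapacity {K : ℕ} (m : ℝ) (X : Fin K → U → ℝ) (y : U → ℝ) (s : ℕ → U)
    (N : ℕ) : ℝ :=
  (empCorr X y s N ⬝ᵥ (pinv (empGram X s N) *ᵥ empCorr X y s N)) / m

end Empirical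

end StationarySystem

/-!
`R_N` lies in the range of `G_N`, so `W = G_N⁺ R_N` solves `G_N W = R_N`, and `R_N ⬝ W` is the
maximum over `V` of `2 V ⬝ R_N - V ⬝ G_N V`. It is therefore a measurable function of the sample,
between `0` and the empirical mean of `y ^ 2`.

Zero capacity means `E[X_i y] = 0`, so `R_N` is itself of the order of the sampling deviation `t`,
and `R_N ⬝ W - R_N ⬝ G⁻¹ R_N = R_N ⬝ G⁻¹ (G - G_N) W` is cubic in `t` when `t` is small. When `t`
is not small, the bounds on the two quadratic forms are `O(t ^ 3)` as well. Rosenthal's inequality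
with exponent `3`, which uses sixth moments of `X` and `y`, gives `E[t ^ 3] = O(N ^ (-3/2))`.
The leading term is exact: `G⁻¹ = Λ Λᵀ` and independence give
`E[R_N ⬝ G⁻¹ R_N] = E[(∑ X̃_l ^ 2) y ^ 2] / N`.
-/

namespace StationarySystem

/-! ### Absolute third moments of sums of independent variables -/

theorem abs_add_pow_three_le (a b : ℝ) :
    |a + b| ^ 3 ≤ |a| ^ 3 + 3 * (a * |a| * b) + 3 * (|a| * b ^ 2) + |b| ^ 3 := by
  have of_nonneg : ∀ {a b : ℝ}, 0 ≤ a →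
      |a + b| ^ 3 ≤ |a| ^ 3 + 3 * (a * |a| * b) + 3 * (|a| * b ^ 2) + |b| ^ 3 := by
    intro a b ha
    rw [abs_of_nonneg ha]
    have hb : b ^ 3 ≤ |b| ^ 3 := by
      rw [← abs_pow]
      exact le_abs_self _
    rcases le_total 0 (a + b) with h | h
    · rw [abs_of_nonneg h]
      linarith [show (a + b) ^ 3 = a ^ 3 + 3 * (a * a * b) + 3 * (a * b ^ 2) + b ^ 3 by ring]
    · have h_le : |a + b| ≤ |b| := by
        rw [abs_of_nonpos h, abs_of_nonpos (by linarith)]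
        linarith
      have h_cube : |a + b| ^ 3 ≤ |b| ^ 3 := by gcongr
      nlinarith [mul_nonneg ha (add_nonneg (sq_nonneg (2 * a + 3 * b)) (sq_nonneg b))]
  rcases le_total 0 a with ha | ha
  · exact of_nonneg ha
  · have h := of_nonneg (b := -b) (neg_nonneg.2 ha)
    rw [← neg_add, abs_neg, abs_neg, abs_neg] at h
    linarith

theorem mul_sqrt_add_mul_sqrt_le {a b : ℝ} (ha : 0 ≤ a) (hb : 0 ≤ b) :
    a * √a + b * √a ≤ (a + b) * √(a + b) := by
  rw [← add_mul]
  gcongr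
  linarith

section IndependentSums

variable {Ω : Type*} [MeasurableSpace Ω] {μ : Measure Ω}

theorem integral_mul_le_sqrt_mul_sqrt {f g : Ω → ℝ} (hf : MemLp f 2 μ) (hg : MemLp g 2 μ)
    (hf0 : 0 ≤ f) (hg0 : 0 ≤ g) :
    ∫ ω, f ω * g ω ∂μ ≤ √(∫ ω, f ω ^ 2 ∂μ) * √(∫ ω, g ω ^ 2 ∂μ) := by
  have h := integral_mul_le_Lp_mul_Lq_of_nonneg Real.HolderConjugate.two_two (ae_of_all μ hf0)
    (ae_of_all μ hg0) (by simpa using hf) (by simpa using hg)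
  simpa [Real.sqrt_eq_rpow] using h

theorem integrable_abs_pow_three {f : Ω → ℝ} (hf : MemLp f 3 μ) :
    Integrable (fun ω => |f ω| ^ 3) μ :=
  MemLp.integrable_norm_pow (p := 3) hf three_ne_zero

variable [IsProbabilityMeasure μ]

theorem integral_abs_le_sqrt_integral_sq {f : Ω → ℝ} (hf : MemLp f 2 μ) :
    ∫ ω, |f ω| ∂μ ≤ √(∫ ω, f ω ^ 2 ∂μ) := by
  simpa using integral_mul_le_sqrt_mul_sqrt hf.abs (memLp_const (1 : ℝ))
    (fun ω => abs_nonneg (f ω)) fun _ => zero_le_one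

theorem integral_abs_add_pow_three_le {S T : Ω → ℝ} (hS : MemLp S 3 μ) (hT : MemLp T 3 μ)
    (hST : IndepFun S T μ) (hT0 : ∫ ω, T ω ∂μ = 0) :
    ∫ ω, |S ω + T ω| ^ 3 ∂μ
      ≤ ∫ ω, |S ω| ^ 3 ∂μ + 3 * ((∫ ω, |S ω| ∂μ) * ∫ ω, T ω ^ 2 ∂μ) + ∫ ω, |T ω| ^ 3 ∂μ := by
  have hS2 : MemLp S 2 μ := hS.mono_exponent (by norm_num)
  have hT2 : MemLp T 2 μ := hT.mono_exponent (by norm_num)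
  have hS1 : Integrable (fun ω => |S ω|) μ := (hS2.integrable one_le_two).abs
  have hSS : Integrable (fun ω => S ω * |S ω|) μ := hS2.integrable_mul hS2.abs
  have ind_linear : IndepFun (fun ω => S ω * |S ω|) T μ :=
    hST.comp (φ := fun x : ℝ => x * |x|) (ψ := id) (by fun_prop) measurable_id
  have ind_quadratic : IndepFun (fun ω => |S ω|) (fun ω => T ω ^ 2) μ :=
    hST.comp (φ := fun x : ℝ => |x|) (ψ := fun x => x ^ 2) (by fun_prop) (by fun_prop)
  have int_linear : Integrable (fun ω => 3 * (S ω * |S ω| * T ω)) μ :=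
    (ind_linear.integrable_mul hSS (hT2.integrable one_le_two)).const_mul 3
  have int_quadratic : Integrable (fun ω => 3 * (|S ω| * T ω ^ 2)) μ :=
    (ind_quadratic.integrable_mul hS1 hT2.integrable_sq).const_mul 3
  have linear_eq_zero : ∫ ω, S ω * |S ω| * T ω ∂μ = 0 := by
    rw [ind_linear.integral_fun_mul_eq_mul_integral hSS.1 hT.1, hT0, mul_zero]
  have hS3 := integrable_abs_pow_three hS
  have hT3 := integrable_abs_pow_three hT
  calc ∫ ω, |S ω + T ω| ^ 3 ∂μ
      ≤ ∫ ω, (|S ω| ^ 3 + 3 * (S ω * |S ω| * T ω) + 3 * (|S ω| * T ω ^ 2) + |T ω| ^ 3) ∂μ :=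
        integral_mono (integrable_abs_pow_three (hS.add hT))
          (((hS3.fun_add int_linear).fun_add int_quadratic).fun_add hT3)
          fun ω => abs_add_pow_three_le (S ω) (T ω)
    _ = _ := by
        rw [integral_add ((hS3.fun_add int_linear).fun_add int_quadratic) hT3,
          integral_add (hS3.fun_add int_linear) int_quadratic, integral_add hS3 int_linear,
          integral_const_mul, integral_const_mul, linear_eq_zero,
          ind_quadratic.integral_fun_mul_eq_mul_integral hS1.1 hT2.integrable_sq.1, mul_zero,
          add_zero]

end IndependentSums

section IndependentFamilies

variable {Ω ι : Type*} [MeasurableSpace Ω] {μ : Measure Ω} {ξ : ι → Ω → ℝ}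

theorem integral_sum_sq_eq_sum_integral_sq (hξ : iIndepFun ξ μ) (hL : ∀ i, MemLp (ξ i) 2 μ)
    (h0 : ∀ i, ∫ ω, ξ i ω ∂μ = 0) (s : Finset ι) :
    ∫ ω, (∑ i ∈ s, ξ i ω) ^ 2 ∂μ = ∑ i ∈ s, ∫ ω, ξ i ω ^ 2 ∂μ := by
  have := hξ.isProbabilityMeasure
  have hsum : ∫ ω, (∑ i ∈ s, ξ i) ω ∂μ = 0 := by
    simp only [Finset.sum_apply]
    rw [integral_finsetSum s fun i _ => (hL i).integrable one_le_two]
    exact Finset.sum_eq_zero fun i _ => h0 i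
  have h := IndepFun.variance_sum (s := s) (fun i _ => hL i) fun i _ j _ hij => hξ.indepFun hij
  rw [variance_of_integral_eq_zero (memLp_finsetSum' s fun i _ => hL i).aemeasurable hsum] at h
  simpa [fun i => variance_of_integral_eq_zero (hL i).aemeasurable (h0 i)] using h

/-- Rosenthal's inequality with exponent three. -/
theorem integral_abs_sum_pow_three_le (hξ : iIndepFun ξ μ) (hL : ∀ i, MemLp (ξ i) 3 μ)
    (h0 : ∀ i, ∫ ω, ξ i ω ∂μ = 0) (s : Finset ι) :
    ∫ ω, |∑ i ∈ s, ξ i ω| ^ 3 ∂μ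
      ≤ ∑ i ∈ s, ∫ ω, |ξ i ω| ^ 3 ∂μ
        + 3 * ((∑ i ∈ s, ∫ ω, ξ i ω ^ 2 ∂μ) * √(∑ i ∈ s, ∫ ω, ξ i ω ^ 2 ∂μ)) := by
  classical
  have := hξ.isProbabilityMeasure
  have hL2 : ∀ i, MemLp (ξ i) 2 μ := fun i => (hL i).mono_exponent (by norm_num)
  induction s using Finset.induction_on with
  | empty => simp
  | insert i s his ih =>
    have hind : IndepFun (fun ω => ∑ j ∈ s, ξ j ω) (ξ i) μ := by
      simpa only [← Finset.sum_apply] using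
        hξ.indepFun_finsetSum_of_notMem₀ (fun j => (hL j).aemeasurable) his
    have first_moment : ∫ ω, |∑ j ∈ s, ξ j ω| ∂μ ≤ √(∑ j ∈ s, ∫ ω, ξ j ω ^ 2 ∂μ) := by
      rw [← integral_sum_sq_eq_sum_integral_sq hξ hL2 h0 s]
      exact integral_abs_le_sqrt_integral_sq (memLp_finsetSum s fun j _ => hL2 j)
    have hsq : ∀ j, 0 ≤ ∫ ω, ξ j ω ^ 2 ∂μ := fun j => integral_nonneg fun ω => sq_nonneg _
    have hstep := integral_abs_add_pow_three_le (memLp_finsetSum s fun j _ => hL j) (hL i) hind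
      (h0 i)
    have hmul := mul_le_mul_of_nonneg_right first_moment (hsq i)
    have hsqrt := mul_sqrt_add_mul_sqrt_le (Finset.sum_nonneg fun j (_ : j ∈ s) => hsq j) (hsq i)
    simp only [Finset.sum_insert his, add_comm (ξ i _), add_comm (∫ ω, ξ i ω ^ 2 ∂μ)]
    linarith

end IndependentFamilies

/-! ### Sample means -/

/-- The empirical mean of `f` over the first `N` points of `s`; it is `0` for `N = 0`. -/
noncomputable def empMean {U : Type*} (f : U → ℝ) (s : ℕ → U) (N : ℕ) : ℝ :=
  (1 / (N : ℝ)) * ∑ n ∈ Finset.range N, f (s n)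

section EmpiricalMean

variable {U : Type*}

theorem empMean_nonneg {f : U → ℝ} (hf : ∀ v, 0 ≤ f v) (s : ℕ → U) (N : ℕ) :
    0 ≤ empMean f s N :=
  mul_nonneg (by positivity) (Finset.sum_nonneg fun n _ => hf (s n))

theorem empMean_sub_const (f : U → ℝ) (c : ℝ) (s : ℕ → U) {N : ℕ} (hN : N ≠ 0) :
    empMean (fun v => f v - c) s N = empMean f s N - c := by
  simp only [empMean, Finset.sum_sub_distrib, Finset.sum_const, Finset.card_range, nsmul_eq_mul]
  field_simp

theorem empMean_const_mul (c : ℝ) (f : U → ℝ) (s : ℕ → U) (N : ℕ) :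
    empMean (fun v => c * f v) s N = c * empMean f s N := by
  simp only [empMean, ← Finset.mul_sum]
  ring

theorem empMean_sum {ι : Type*} (t : Finset ι) (f : ι → U → ℝ) (s : ℕ → U) (N : ℕ) :
    empMean (fun v => ∑ i ∈ t, f i v) s N = ∑ i ∈ t, empMean (f i) s N := by
  simp only [empMean, ← Finset.mul_sum]
  rw [Finset.sum_comm]

end EmpiricalMean

section Sampling

variable {U Ω : Type*} [MeasurableSpace U] [MeasurableSpace Ω] {p : Measure U} {μ : Measure Ω}
  {u : ℕ → Ω → U}

theorem memLp_comp_of_hasLaw {X : Ω → U} (hX : HasLaw X p μ) {f : U → ℝ} {q : ENNReal}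
    (hf : MemLp f q p) : MemLp (fun ω => f (X ω)) q μ := by
  rw [← hX.map_eq] at hf
  exact hf.comp_of_map hX.aemeasurable

theorem memLp_empMean (hu : ∀ n, HasLaw (u n) p μ) {f : U → ℝ} {q : ENNReal}
    (hf : MemLp f q p) (N : ℕ) : MemLp (fun ω => empMean f (fun n => u n ω) N) q μ :=
  (memLp_finsetSum _ fun n _ => memLp_comp_of_hasLaw (hu n) hf).const_mul _

theorem iIndepFun_comp_hasLaw (hu : ∀ n, HasLaw (u n) p μ) (hi : iIndepFun u μ) {f : U → ℝ}
    (hf : AEMeasurable f p) : iIndepFun (fun n ω => f (u n ω)) μ :=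
  hi.comp₀ (fun _ => f) (fun n => (hu n).aemeasurable) fun n => by rwa [(hu n).map_eq]

theorem integral_empMean_sq (hu : ∀ n, HasLaw (u n) p μ) (hi : iIndepFun u μ) {f : U → ℝ}
    (hf : MemLp f 2 p) (h0 : ∫ v, f v ∂p = 0) (N : ℕ) :
    ∫ ω, empMean f (fun n => u n ω) N ^ 2 ∂μ = (∫ v, f v ^ 2 ∂p) / N := by
  have h := integral_sum_sq_eq_sum_integral_sq (iIndepFun_comp_hasLaw hu hi hf.aemeasurable)
    (fun n => memLp_comp_of_hasLaw (hu n) hf)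
    (fun n => ((hu n).integral_comp hf.1).trans h0) (Finset.range N)
  have hterm : ∀ n, ∫ ω, f (u n ω) ^ 2 ∂μ = ∫ v, f v ^ 2 ∂p :=
    fun n => (hu n).integral_comp (f := fun v => f v ^ 2) hf.integrable_sq.1
  simp only [hterm, Finset.sum_const, Finset.card_range, nsmul_eq_mul] at h
  simp only [empMean, mul_pow, integral_const_mul, h]
  rcases eq_or_ne N 0 with rfl | hN
  · simp
  · field_simp

theorem one_div_pow_three_mul_mul_sqrt {x : ℝ} (hx : 0 < x) :
    (1 / x) ^ 3 * (x * √x) = x ^ (-(3 / 2) : ℝ) := by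
  rw [Real.sqrt_eq_rpow, one_div, inv_pow, ← Real.rpow_natCast, ← Real.rpow_neg hx.le]
  nth_rw 2 [← Real.rpow_one x]
  rw [← Real.rpow_add hx, ← Real.rpow_add hx]
  norm_num

theorem integral_abs_empMean_pow_three_le (hu : ∀ n, HasLaw (u n) p μ) (hi : iIndepFun u μ)
    {f : U → ℝ} (hf : MemLp f 3 p) (h0 : ∫ v, f v ∂p = 0) {N : ℕ} (hN : N ≠ 0) :
    ∫ ω, |empMean f (fun n => u n ω) N| ^ 3 ∂μ
      ≤ (∫ v, |f v| ^ 3 ∂p + 3 * ((∫ v, f v ^ 2 ∂p) * √(∫ v, f v ^ 2 ∂p)))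
        * (N : ℝ) ^ (-(3 / 2) : ℝ) := by
  have := hi.isProbabilityMeasure
  have hN1 : (1 : ℝ) ≤ N := mod_cast Nat.one_le_iff_ne_zero.2 hN
  set ρ := ∫ v, |f v| ^ 3 ∂p
  set σ := ∫ v, f v ^ 2 ∂p
  have hρ : 0 ≤ ρ := integral_nonneg fun v => by positivity
  have hcube : ∀ n, ∫ ω, |f (u n ω)| ^ 3 ∂μ = ρ :=
    fun n => (hu n).integral_comp (f := fun v => |f v| ^ 3) (integrable_abs_pow_three hf).1
  have hsq : ∀ n, ∫ ω, f (u n ω) ^ 2 ∂μ = σ :=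
    fun n => (hu n).integral_comp (f := fun v => f v ^ 2) (hf.1.pow 2)
  have rosenthal := integral_abs_sum_pow_three_le
    (iIndepFun_comp_hasLaw hu hi hf.aemeasurable)
    (fun n => memLp_comp_of_hasLaw (hu n) hf)
    (fun n => ((hu n).integral_comp hf.1).trans h0) (Finset.range N)
  simp only [hcube, hsq, Finset.sum_const, Finset.card_range, nsmul_eq_mul] at rosenthal
  rw [Real.sqrt_mul N.cast_nonneg] at rosenthal
  have hsqrt : N * ρ ≤ N * √N * ρ :=
    mul_le_mul_of_nonneg_right
      (le_mul_of_one_le_right N.cast_nonneg (Real.one_le_sqrt.2 hN1)) hρ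
  simp only [empMean, abs_mul, mul_pow, integral_const_mul]
  rw [abs_of_nonneg (by positivity : (0 : ℝ) ≤ 1 / N),
    ← one_div_pow_three_mul_mul_sqrt (zero_lt_one.trans_le hN1), mul_left_comm]
  gcongr
  linarith

theorem exists_integral_sum_abs_empMean_sub_pow_three_le [IsProbabilityMeasure p] {ι : Type*}
    [Fintype ι] (hu : ∀ n, HasLaw (u n) p μ) (hi : iIndepFun u μ) {F : ι → U → ℝ}
    (hF : ∀ k, MemLp (F k) 3 p) :
    ∃ C : ℝ, ∀ N : ℕ, N ≠ 0 →
      ∫ ω, (∑ k, |empMean (F k) (fun n => u n ω) N - ∫ v, F k v ∂p|) ^ 3 ∂μ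
        ≤ C * (N : ℝ) ^ (-(3 / 2) : ℝ) := by
  set f : ι → U → ℝ := fun k v => F k v - ∫ w, F k w ∂p
  have hf : ∀ k, MemLp (f k) 3 p := fun k => (hF k).sub (memLp_const _)
  have h0 : ∀ k, ∫ v, f k v ∂p = 0 := fun k => by
    rw [integral_sub ((hF k).integrable (by norm_num)) (integrable_const _)]
    simp
  set c : ι → ℝ := fun k =>
    ∫ v, |f k v| ^ 3 ∂p + 3 * ((∫ v, f k v ^ 2 ∂p) * √(∫ v, f k v ^ 2 ∂p))
  refine ⟨(Fintype.card ι : ℝ) ^ 2 * ∑ k, c k, fun N hN => ?_⟩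
  have hint : ∀ k, Integrable (fun ω => |empMean (f k) (fun n => u n ω) N| ^ 3) μ :=
    fun k => integrable_abs_pow_three (memLp_empMean hu (hf k) N)
  simp only [← empMean_sub_const _ _ _ hN]
  calc ∫ ω, (∑ k, |empMean (f k) (fun n => u n ω) N|) ^ 3 ∂μ
      ≤ ∫ ω, (Fintype.card ι : ℝ) ^ 2 * ∑ k, |empMean (f k) (fun n => u n ω) N| ^ 3 ∂μ :=
        integral_mono_of_nonneg (ae_of_all _ fun ω => by positivity)
          ((integrable_finsetSum _ fun k _ => hint k).const_mul _)
          (ae_of_all _ fun ω => pow_sum_le_card_mul_sum_pow (fun k _ => abs_nonneg _) 2)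
    _ = (Fintype.card ι : ℝ) ^ 2 * ∑ k, ∫ ω, |empMean (f k) (fun n => u n ω) N| ^ 3 ∂μ := by
        rw [integral_const_mul, integral_finsetSum _ fun k _ => hint k]
    _ ≤ (Fintype.card ι : ℝ) ^ 2 * ∑ k, c k * (N : ℝ) ^ (-(3 / 2) : ℝ) := by
        gcongr with k
        exact integral_abs_empMean_pow_three_le hu hi (hf k) (h0 k) hN
    _ = (Fintype.card ι : ℝ) ^ 2 * (∑ k, c k) * (N : ℝ) ^ (-(3 / 2) : ℝ) := by
        rw [← Finset.sum_mul, mul_assoc]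

end Sampling

/-! ### Deviation of the empirical Gram matrix -/

/-- The entrywise `ℓ¹` distance between the empirical and the population Gram matrix. It is used
for the readouts together with the target, so that it controls `G_N`, `R_N` and the empirical
mean of `y ^ 2` simultaneously. -/
noncomputable def gramDev {U : Type*} [MeasurableSpace U] {K : ℕ} (p : Measure U)
    (X : Fin K → U → ℝ) (s : ℕ → U) (N : ℕ) : ℝ :=
  ∑ i, ∑ j, |empGram X s N i j - gram p X i j|

section GramDeviation

variable {U : Type*} [MeasurableSpace U] {p : Measure U} {K : ℕ}

theorem memLp_mul {f g : U → ℝ} {q r : ENNReal} (hf : MemLp f r p) (hg : MemLp g r p)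
    (hr : r = 2 * q) : MemLp (fun v => f v * g v) q p := by
  have : ENNReal.HolderTriple r r q := ⟨by
    rw [hr, ENNReal.mul_inv (by simp) (by simp), ← add_mul, ENNReal.inv_two_add_inv_two, one_mul]⟩
  exact hg.mul' hf

theorem memLp_gramDev {Ω : Type*} [MeasurableSpace Ω] {μ : Measure Ω} [IsFiniteMeasure μ]
    {u : ℕ → Ω → U} {X : Fin K → U → ℝ} (hX : ∀ i, MemLp (X i) 6 p)
    (hu : ∀ n, HasLaw (u n) p μ) (N : ℕ) :
    MemLp (fun ω => gramDev p X (fun n => u n ω) N) 3 μ :=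
  memLp_finsetSum _ fun i _ => memLp_finsetSum _ fun j _ =>
    ((memLp_empMean hu (memLp_mul (hX i) (hX j) (by norm_num)) N).sub (memLp_const _)).abs

theorem exists_integral_gramDev_pow_three_le [IsProbabilityMeasure p] {Ω : Type*}
    [MeasurableSpace Ω] {μ : Measure Ω} {u : ℕ → Ω → U} {X : Fin K → U → ℝ}
    (hX : ∀ i, MemLp (X i) 6 p) (hu : ∀ n, HasLaw (u n) p μ) (hi : iIndepFun u μ) :
    ∃ C : ℝ, ∀ N : ℕ, N ≠ 0 →
      ∫ ω, gramDev p X (fun n => u n ω) N ^ 3 ∂μ ≤ C * (N : ℝ) ^ (-(3 / 2) : ℝ) := by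
  have h := exists_integral_sum_abs_empMean_sub_pow_three_le hu hi
    fun ij : Fin K × Fin K => memLp_mul (q := 3) (hX ij.1) (hX ij.2) (by norm_num)
  simp only [Fintype.sum_prod_type] at h
  exact h

theorem gramDev_nonneg (X : Fin K → U → ℝ) (s : ℕ → U) (N : ℕ) : 0 ≤ gramDev p X s N :=
  Finset.sum_nonneg fun _ _ => Finset.sum_nonneg fun _ _ => abs_nonneg _

theorem abs_empGram_sub_gram_le (X : Fin K → U → ℝ) (s : ℕ → U) (N : ℕ) (i j : Fin K) :
    |empGram X s N i j - gram p X i j| ≤ gramDev p X s N :=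
  (Finset.single_le_sum (f := fun j => |empGram X s N i j - gram p X i j|)
    (fun _ _ => abs_nonneg _) (Finset.mem_univ j)).trans
  (Finset.single_le_sum (f := fun i => ∑ j, |empGram X s N i j - gram p X i j|)
    (fun _ _ => Finset.sum_nonneg fun _ _ => abs_nonneg _) (Finset.mem_univ i))

theorem gramDev_le_gramDev_cons (X : Fin K → U → ℝ) (y : U → ℝ) (s : ℕ → U) (N : ℕ) :
    gramDev p X s N ≤ gramDev p (Fin.cons y X : Fin (K + 1) → U → ℝ) s N := by
  rw [gramDev, gramDev, Fin.sum_univ_succ]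
  refine le_add_of_nonneg_of_le (Finset.sum_nonneg fun _ _ => abs_nonneg _) ?_
  refine Finset.sum_le_sum fun i _ => ?_
  rw [Fin.sum_univ_succ]
  exact le_add_of_nonneg_of_le (abs_nonneg _) le_rfl

theorem abs_empCorr_sub_le (X : Fin K → U → ℝ) (y : U → ℝ) (s : ℕ → U) (N : ℕ) (i : Fin K) :
    |empCorr X y s N i - ∫ v, X i v * y v ∂p|
      ≤ gramDev p (Fin.cons y X : Fin (K + 1) → U → ℝ) s N :=
  abs_empGram_sub_gram_le (Fin.cons y X : Fin (K + 1) → U → ℝ) s N i.succ 0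

theorem empMean_sq_le (X : Fin K → U → ℝ) (y : U → ℝ) (s : ℕ → U) (N : ℕ) :
    empMean (fun v => y v ^ 2) s N
      ≤ ∫ v, y v ^ 2 ∂p + gramDev p (Fin.cons y X : Fin (K + 1) → U → ℝ) s N := by
  have h := abs_empGram_sub_gram_le (p := p) (Fin.cons y X : Fin (K + 1) → U → ℝ) s N 0 0
  simp only [empGram, gram, Matrix.of_apply, Fin.cons_zero, ← pow_two] at h
  exact sub_le_iff_le_add'.1 ((le_abs_self _).trans h)

end GramDeviation

/-! ### Solutions of the normal equations -/

section NormalEquations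

variable {ι : Type*} [Fintype ι]

theorem isGreatest_range_two_mul_dotProduct_sub {A : Matrix ι ι ℝ} (hA : A.PosSemidef)
    {R W : ι → ℝ} (hW : A *ᵥ W = R) :
    IsGreatest (Set.range fun V => 2 * (V ⬝ᵥ R) - V ⬝ᵥ (A *ᵥ V)) (R ⬝ᵥ W) := by
  refine ⟨⟨W, ?_⟩, ?_⟩
  · simp only [hW, dotProduct_comm W R]
    ring
  · rintro _ ⟨V, rfl⟩
    have h : 0 ≤ (V - W) ⬝ᵥ (A *ᵥ (V - W)) := hA.dotProduct_mulVec_nonneg (V - W)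
    have hsymm : W ⬝ᵥ (A *ᵥ V) = V ⬝ᵥ R := by
      have hT : Aᵀ = A := hA.isHermitian
      rw [dotProduct_mulVec, ← mulVec_transpose, hT, hW, dotProduct_comm]
    rw [mulVec_sub, hW, sub_dotProduct, dotProduct_sub, dotProduct_sub, hsymm,
      dotProduct_comm W R] at h
    linarith

theorem aemeasurable_dotProduct_of_mulVec_eq {Ω : Type*} [MeasurableSpace Ω] {μ : Measure Ω}
    {A : Ω → Matrix ι ι ℝ} {R W : Ω → ι → ℝ} (hA : ∀ i j, AEMeasurable (fun ω => A ω i j) μ)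
    (hR : ∀ i, AEMeasurable (fun ω => R ω i) μ) (hpos : ∀ ω, (A ω).PosSemidef)
    (hW : ∀ ω, A ω *ᵥ W ω = R ω) : AEMeasurable (fun ω => R ω ⬝ᵥ W ω) μ := by
  let V := TopologicalSpace.denseSeq (ι → ℝ)
  refine AEMeasurable.isLUB (f := fun k ω => 2 * (V k ⬝ᵥ R ω) - V k ⬝ᵥ (A ω *ᵥ V k))
    (fun k => ?_) (ae_of_all _ fun ω => ?_)
  · simp only [dotProduct, mulVec]
    fun_prop
  · have hcont : Continuous fun v : ι → ℝ => 2 * (v ⬝ᵥ R ω) - v ⬝ᵥ (A ω *ᵥ v) := by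
      simp only [dotProduct, mulVec]
      fun_prop
    have hdense := hcont.range_subset_closure_image_dense
      (TopologicalSpace.denseRange_denseSeq (ι → ℝ))
    rw [← Set.range_comp] at hdense
    exact (isLUB_iff_of_subset_of_subset_closure (Set.range_comp_subset_range _ _) hdense).2
      (isGreatest_range_two_mul_dotProduct_sub (hpos ω) (hW ω)).isLUB

theorem mulVec_pinv_mulVec_eq_of_le {K : ℕ} {A : Matrix (Fin K) (Fin K) ℝ} (hA : Aᵀ = A)
    {R : Fin K → ℝ} {c : ℝ} (hc : ∀ V, 2 * (V ⬝ᵥ R) - V ⬝ᵥ (A *ᵥ V) ≤ c) :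
    A *ᵥ (pinv A *ᵥ R) = R := by
  have hP := isPseudoInverse_pinv hA
  set v := R - A *ᵥ (pinv A *ᵥ R) with hv
  have hAv : A *ᵥ v = 0 := by
    have h : A * (A * pinv A) = A := by
      calc A * (A * pinv A) = (A * pinv A * A)ᵀ := by
            rw [transpose_mul, hP.left_symm, hA]
        _ = A := by rw [hP.mul_mul_self, hA]
    rw [hv, mulVec_sub, mulVec_mulVec, mulVec_mulVec, Matrix.mul_assoc, h, sub_self]
  have hvR : v ⬝ᵥ R = v ⬝ᵥ v := by
    have h : v ⬝ᵥ (A *ᵥ (pinv A *ᵥ R)) = 0 := by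
      rw [dotProduct_mulVec, ← mulVec_transpose, hA, hAv, zero_dotProduct]
    nth_rw 3 [hv]
    rw [dotProduct_sub, h, sub_zero]
  have hbound : ∀ a : ℝ, 2 * (a * (v ⬝ᵥ v)) ≤ c := fun a => by
    simpa [mulVec_smul, hAv, hvR] using hc (a • v)
  have hvv : v ⬝ᵥ v = 0 := by
    by_contra hne
    have h := hbound ((c + 1) / (v ⬝ᵥ v))
    rw [div_mul_cancel₀ _ hne] at h
    linarith [hbound 0]
  exact (sub_eq_zero.1 (dotProduct_self_eq_zero.1 hvv)).symm

end NormalEquations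

/-! ### Perturbation of the normal equations -/

section Perturbation

open scoped Matrix.Norms.Operator

variable {ι : Type*} [Fintype ι]

theorem abs_dotProduct_le (v w : ι → ℝ) : |v ⬝ᵥ w| ≤ Fintype.card ι * (‖v‖ * ‖w‖) := by
  calc |v ⬝ᵥ w| ≤ ∑ i, |v i * w i| := Finset.abs_sum_le_sum_abs _ _
    _ ≤ ∑ _i : ι, ‖v‖ * ‖w‖ := by
        gcongr with i
        rw [abs_mul]
        exact mul_le_mul (norm_le_pi_norm v i) (norm_le_pi_norm w i) (abs_nonneg _)
          (norm_nonneg v)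
    _ = Fintype.card ι * (‖v‖ * ‖w‖) := by simp

theorem norm_le_sum_abs (M : Matrix ι ι ℝ) : ‖M‖ ≤ ∑ i, ∑ j, |M i j| := by
  rw [linfty_opNorm_def, ← NNReal.coe_mk (∑ i, ∑ j, |M i j|) (by positivity), NNReal.coe_le_coe]
  refine Finset.sup_le fun i _ => NNReal.coe_le_coe.1 ?_
  push_cast
  exact Finset.single_le_sum (f := fun i => ∑ j, |M i j|)
    (fun i _ => Finset.sum_nonneg fun j _ => abs_nonneg _) (Finset.mem_univ i)

variable [DecidableEq ι] {A G : Matrix ι ι ℝ} {R W : ι → ℝ}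

theorem sub_inv_mulVec_eq (hG : IsUnit G.det) (hW : A *ᵥ W = R) :
    W - G⁻¹ *ᵥ R = G⁻¹ *ᵥ ((G - A) *ᵥ W) := by
  rw [sub_mulVec, hW, mulVec_sub, mulVec_mulVec, nonsing_inv_mul G hG, one_mulVec]

theorem norm_sub_inv_mulVec_le (hG : IsUnit G.det) (hW : A *ᵥ W = R) :
    ‖W - G⁻¹ *ᵥ R‖ ≤ ‖G⁻¹‖ * (‖A - G‖ * ‖W‖) := by
  rw [sub_inv_mulVec_eq hG hW, norm_sub_rev A G]
  exact (linfty_opNorm_mulVec _ _).trans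
    (mul_le_mul_of_nonneg_left (linfty_opNorm_mulVec _ _) (norm_nonneg _))

theorem norm_le_of_mulVec_eq (hG : IsUnit G.det) (hW : A *ᵥ W = R)
    (hAG : ‖G⁻¹‖ * ‖A - G‖ ≤ 1 / 2) : ‖W‖ ≤ 2 * (‖G⁻¹‖ * ‖R‖) := by
  have h1 := norm_sub_inv_mulVec_le hG hW
  have h2 : ‖W‖ ≤ ‖W - G⁻¹ *ᵥ R‖ + ‖G⁻¹ *ᵥ R‖ := norm_le_norm_sub_add W (G⁻¹ *ᵥ R)
  have h3 := linfty_opNorm_mulVec G⁻¹ R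
  have h4 := mul_le_mul_of_nonneg_right hAG (norm_nonneg W)
  linarith

variable {t : ℝ}

theorem abs_inv_quadratic_le (G : Matrix ι ι ℝ) (hR : ‖R‖ ≤ t) :
    |R ⬝ᵥ (G⁻¹ *ᵥ R)| ≤ Fintype.card ι * ‖G⁻¹‖ * t ^ 2 := by
  have ht : 0 ≤ t := (norm_nonneg R).trans hR
  calc |R ⬝ᵥ (G⁻¹ *ᵥ R)| ≤ Fintype.card ι * (‖R‖ * (‖G⁻¹‖ * ‖R‖)) :=
        (abs_dotProduct_le _ _).trans (by gcongr; exact linfty_opNorm_mulVec _ _)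
    _ ≤ Fintype.card ι * (t * (‖G⁻¹‖ * t)) := by gcongr
    _ = Fintype.card ι * ‖G⁻¹‖ * t ^ 2 := by ring

theorem abs_dotProduct_sub_inv_quadratic_le_of_small (hG : IsUnit G.det) (hW : A *ᵥ W = R)
    (hA : ‖A - G‖ ≤ t) (hR : ‖R‖ ≤ t) (ht : ‖G⁻¹‖ * t ≤ 1 / 2) :
    |R ⬝ᵥ W - R ⬝ᵥ (G⁻¹ *ᵥ R)| ≤ 2 * Fintype.card ι * ‖G⁻¹‖ ^ 2 * t ^ 3 := by
  have ht0 : 0 ≤ t := (norm_nonneg R).trans hR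
  have hWt : ‖W‖ ≤ 2 * (‖G⁻¹‖ * t) :=
    (norm_le_of_mulVec_eq hG hW ((by gcongr : ‖G⁻¹‖ * ‖A - G‖ ≤ ‖G⁻¹‖ * t).trans ht)).trans
      (by gcongr)
  rw [← dotProduct_sub]
  calc |R ⬝ᵥ (W - G⁻¹ *ᵥ R)| ≤ Fintype.card ι * (‖R‖ * (‖G⁻¹‖ * (‖A - G‖ * ‖W‖))) :=
        (abs_dotProduct_le _ _).trans (by gcongr; exact norm_sub_inv_mulVec_le hG hW)
    _ ≤ Fintype.card ι * (t * (‖G⁻¹‖ * (t * (2 * (‖G⁻¹‖ * t))))) := by gcongr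
    _ = 2 * Fintype.card ι * ‖G⁻¹‖ ^ 2 * t ^ 3 := by ring

theorem abs_dotProduct_sub_inv_quadratic_le {m : ℝ} (hG : IsUnit G.det) (hW : A *ᵥ W = R)
    (hA : ‖A - G‖ ≤ t) (hR : ‖R‖ ≤ t) (h0 : 0 ≤ R ⬝ᵥ W) (hm : 0 ≤ m) (hmt : R ⬝ᵥ W ≤ m + t) :
    |R ⬝ᵥ W - R ⬝ᵥ (G⁻¹ *ᵥ R)|
      ≤ (2 * Fintype.card ι * ‖G⁻¹‖ ^ 2 + 8 * m * ‖G⁻¹‖ ^ 3 + 4 * ‖G⁻¹‖ ^ 2) * t ^ 3 := by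
  have ht : 0 ≤ t := (norm_nonneg R).trans hR
  set g := ‖G⁻¹‖
  rcases le_or_gt (g * t) (1 / 2) with hsmall | hlarge
  · refine (abs_dotProduct_sub_inv_quadratic_le_of_small hG hW hA hR hsmall).trans ?_
    gcongr
    have : 0 ≤ 8 * m * g ^ 3 + 4 * g ^ 2 := by positivity
    linarith
  · -- Powers of `2 * g * t ≥ 1` raise the trivial bounds to third order in `t`.
    have hgt : 1 ≤ 2 * (g * t) := by linarith
    have h_emp : |R ⬝ᵥ W| ≤ m * (2 * (g * t)) ^ 3 + t * (2 * (g * t)) ^ 2 := by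
      rw [abs_of_nonneg h0]
      exact hmt.trans (add_le_add (le_mul_of_one_le_right hm (one_le_pow₀ hgt))
        (le_mul_of_one_le_right ht (one_le_pow₀ hgt)))
    have h_inv : |R ⬝ᵥ (G⁻¹ *ᵥ R)| ≤ Fintype.card ι * g * t ^ 2 * (2 * (g * t)) :=
      (abs_inv_quadratic_le G hR).trans (le_mul_of_one_le_right (by positivity) hgt)
    calc |R ⬝ᵥ W - R ⬝ᵥ (G⁻¹ *ᵥ R)| ≤ |R ⬝ᵥ W| + |R ⬝ᵥ (G⁻¹ *ᵥ R)| := abs_sub _ _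
      _ ≤ _ := add_le_add h_emp h_inv
      _ = _ := by ring

end Perturbation

/-! ### The empirical normal equations -/

section EmpiricalNormalEquations

variable {U : Type*} {K : ℕ}

theorem dotProduct_empCorr (X : Fin K → U → ℝ) (y : U → ℝ) (s : ℕ → U) (N : ℕ) (W : Fin K → ℝ) :
    W ⬝ᵥ empCorr X y s N = empMean (fun v => (∑ i, W i * X i v) * y v) s N := by
  simp only [Finset.sum_mul, mul_assoc, empMean_sum, empMean_const_mul]
  rfl

theorem empGram_mulVec (X : Fin K → U → ℝ) (s : ℕ → U) (N : ℕ) (W : Fin K → ℝ) :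
    empGram X s N *ᵥ W = empCorr X (fun v => ∑ i, W i * X i v) s N := by
  ext i
  change _ = empMean (fun v => X i v * ∑ j, W j * X j v) s N
  simp only [Finset.mul_sum, mul_left_comm (X i _), empMean_sum, empMean_const_mul]
  exact dotProduct_comm _ _

theorem empMean_sq_sub (X : Fin K → U → ℝ) (y : U → ℝ) (s : ℕ → U) (N : ℕ) (W : Fin K → ℝ) :
    empMean (fun v => ((∑ i, W i * X i v) - y v) ^ 2) s N
      = W ⬝ᵥ (empGram X s N *ᵥ W) - 2 * (W ⬝ᵥ empCorr X y s N)
        + empMean (fun v => y v ^ 2) s N := by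
  rw [empGram_mulVec, dotProduct_empCorr, dotProduct_empCorr]
  simp only [empMean, sub_sq, Finset.sum_add_distrib, Finset.sum_sub_distrib, mul_assoc,
    ← Finset.mul_sum, ← pow_two]
  ring

theorem two_mul_dotProduct_empCorr_sub_le (X : Fin K → U → ℝ) (y : U → ℝ) (s : ℕ → U) (N : ℕ)
    (W : Fin K → ℝ) :
    2 * (W ⬝ᵥ empCorr X y s N) - W ⬝ᵥ (empGram X s N *ᵥ W)
      ≤ empMean (fun v => y v ^ 2) s N := by
  have h := empMean_nonneg (fun v => sq_nonneg ((∑ i, W i * X i v) - y v)) s N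
  rw [empMean_sq_sub] at h
  linarith

theorem transpose_empGram (X : Fin K → U → ℝ) (s : ℕ → U) (N : ℕ) :
    (empGram X s N)ᵀ = empGram X s N := by
  ext i j
  simp only [empGram, transpose_apply, of_apply, mul_comm]

theorem posSemidef_empGram (X : Fin K → U → ℝ) (s : ℕ → U) (N : ℕ) :
    (empGram X s N).PosSemidef := by
  refine PosSemidef.of_dotProduct_mulVec_nonneg (transpose_empGram X s N) fun W => ?_
  rw [star_trivial, empGram_mulVec, dotProduct_empCorr]
  exact empMean_nonneg (fun v => mul_self_nonneg _) s N

theorem empGram_mulVec_pinv_mulVec_empCorr (X : Fin K → U → ℝ) (y : U → ℝ) (s : ℕ → U) (N : ℕ) :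
    empGram X s N *ᵥ (pinv (empGram X s N) *ᵥ empCorr X y s N) = empCorr X y s N :=
  mulVec_pinv_mulVec_eq_of_le (transpose_empGram X s N)
    (two_mul_dotProduct_empCorr_sub_le X y s N)

theorem isGreatest_pinv_empGram_quadratic (X : Fin K → U → ℝ) (y : U → ℝ) (s : ℕ → U) (N : ℕ) :
    IsGreatest (Set.range fun V =>
        2 * (V ⬝ᵥ empCorr X y s N) - V ⬝ᵥ (empGram X s N *ᵥ V))
      (empCorr X y s N ⬝ᵥ (pinv (empGram X s N) *ᵥ empCorr X y s N)) :=
  isGreatest_range_two_mul_dotProduct_sub (posSemidef_empGram X s N)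
    (empGram_mulVec_pinv_mulVec_empCorr X y s N)

theorem pinv_empGram_quadratic_nonneg (X : Fin K → U → ℝ) (y : U → ℝ) (s : ℕ → U) (N : ℕ) :
    0 ≤ empCorr X y s N ⬝ᵥ (pinv (empGram X s N) *ᵥ empCorr X y s N) :=
  (isGreatest_pinv_empGram_quadratic X y s N).2 ⟨0, by simp⟩

theorem pinv_empGram_quadratic_le (X : Fin K → U → ℝ) (y : U → ℝ) (s : ℕ → U) (N : ℕ) :
    empCorr X y s N ⬝ᵥ (pinv (empGram X s N) *ᵥ empCorr X y s N)
      ≤ empMean (fun v => y v ^ 2) s N := by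
  obtain ⟨V, hV⟩ := (isGreatest_pinv_empGram_quadratic X y s N).1
  exact hV ▸ two_mul_dotProduct_empCorr_sub_le X y s N V

theorem empCorr_quadratic_mul_transpose (X : Fin K → U → ℝ) (y : U → ℝ) (s : ℕ → U) (N : ℕ)
    (Λ : Matrix (Fin K) (Fin K) ℝ) :
    empCorr X y s N ⬝ᵥ ((Λ * Λᵀ) *ᵥ empCorr X y s N)
      = ∑ l, empMean (fun v => transformed X Λ l v * y v) s N ^ 2 := by
  have h : ∀ l, (Λᵀ *ᵥ empCorr X y s N) l = empMean (fun v => transformed X Λ l v * y v) s N := by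
    intro l
    change (fun i => Λ i l) ⬝ᵥ empCorr X y s N = _
    rw [dotProduct_empCorr]
    simp only [transformed, mul_comm]
  rw [← mulVec_mulVec, dotProduct_mulVec, ← mulVec_transpose, dotProduct]
  simp only [h, pow_two]

end EmpiricalNormalEquations

/-! ### Vanishing capacity and the leading coefficient -/

section Population

variable {U : Type*} [MeasurableSpace U] {p : Measure U} {K : ℕ} {X : Fin K → U → ℝ} {y : U → ℝ}

theorem mse_single (hX : ∀ i, MemLp (X i) 2 p) (hy : MemLp y 2 p) (i : Fin K) (a : ℝ) :
    mse p X y (Pi.single i a)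
      = (∫ v, X i v ^ 2 ∂p) * (a * a) + -2 * (∫ v, X i v * y v ∂p) * a + ∫ v, y v ^ 2 ∂p := by
  have hXX : Integrable (fun v => X i v ^ 2 * (a * a)) p := (hX i).integrable_sq.mul_const _
  have hXy : Integrable (fun v => -2 * (X i v * y v) * a) p :=
    (((hX i).integrable_mul hy).const_mul _).mul_const _
  rw [← integral_const_mul, ← integral_mul_const, ← integral_mul_const, ← integral_add hXX hXy,
    ← integral_add (hXX.fun_add hXy) hy.integrable_sq]
  refine integral_congr_ae (ae_of_all _ fun v => ?_)
  have hsum : ∑ j, (Pi.single i a : Fin K → ℝ) j * X j v = a * X i v :=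
    single_dotProduct (fun j => X j v) a i
  simp only [hsum]
  ring

theorem minMse_le_mse (W : Fin K → ℝ) : minMse p X y ≤ mse p X y W :=
  ciInf_le ⟨0, by rintro _ ⟨W, rfl⟩; exact integral_nonneg fun v => sq_nonneg _⟩ W

theorem integral_mul_eq_zero_of_capacity_eq_zero (hX : ∀ i, MemLp (X i) 2 p) (hy : MemLp y 2 p)
    (hC : capacity p X y = 0) (i : Fin K) : ∫ v, X i v * y v ∂p = 0 := by
  have hmin : minMse p X y = ∫ v, y v ^ 2 ∂p := eq_of_div_eq_one (sub_eq_zero.1 hC).symm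
  have hquad : ∀ a : ℝ,
      0 ≤ (∫ v, X i v ^ 2 ∂p) * (a * a) + -2 * (∫ v, X i v * y v ∂p) * a + 0 := fun a => by
    have h := minMse_le_mse (p := p) (X := X) (y := y) (Pi.single i a)
    rw [hmin, mse_single hX hy] at h
    linarith
  have h := discrim_le_zero hquad
  rw [discrim] at h
  nlinarith

theorem memLp_transformed {q : ENNReal} (hX : ∀ i, MemLp (X i) q p)
    (Λ : Matrix (Fin K) (Fin K) ℝ) (l : Fin K) : MemLp (transformed X Λ l) q p :=
  memLp_finsetSum _ fun i _ => (hX i).mul_const (Λ i l)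

theorem integral_transformed_mul_eq_zero (hX : ∀ i, MemLp (X i) 2 p) (hy : MemLp y 2 p)
    (h0 : ∀ i, ∫ v, X i v * y v ∂p = 0) (Λ : Matrix (Fin K) (Fin K) ℝ) (l : Fin K) :
    ∫ v, transformed X Λ l v * y v ∂p = 0 := by
  have hint : ∀ i, Integrable (fun v => X i v * y v * Λ i l) p :=
    fun i => ((hX i).integrable_mul hy).mul_const _
  simp only [transformed, Finset.sum_mul, mul_right_comm _ (Λ _ l)]
  rw [integral_finsetSum _ fun i _ => hint i]
  simp only [integral_mul_const, h0, zero_mul, Finset.sum_const_zero]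

theorem Delta_le (hX : ∀ i, MemLp (X i) 4 p) (hy : MemLp y 4 p) :
    Delta p X y
      ≤ √((∫ v, (∑ i, X i v ^ 2) ^ 2 ∂p) * ∫ v, y v ^ 4 ∂p) / ∫ v, y v ^ 2 ∂p := by
  have sq_memLp : ∀ {f : U → ℝ}, MemLp f 4 p → MemLp (fun v => f v ^ 2) 2 p := fun hf => by
    simpa only [pow_two] using memLp_mul (q := 2) hf hf (by norm_num)
  refine div_le_div_of_nonneg_right ?_ (integral_nonneg fun v => sq_nonneg (y v))
  rw [Real.sqrt_mul (integral_nonneg fun v => sq_nonneg _)]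
  have h := integral_mul_le_sqrt_mul_sqrt (memLp_finsetSum Finset.univ fun i _ => sq_memLp (hX i))
    (sq_memLp hy) (fun v => Finset.sum_nonneg fun i _ => sq_nonneg (X i v))
    fun v => sq_nonneg (y v)
  simpa only [← pow_mul] using h

theorem inv_eq_mul_transpose {G Λ : Matrix (Fin K) (Fin K) ℝ} (h : Λᵀ * G * Λ = 1) :
    G⁻¹ = Λ * Λᵀ :=
  Matrix.inv_eq_left_inv (by rw [Matrix.mul_assoc]; exact mul_eq_one_comm.1 h)

end Population

/-! ### Expectation of the empirical quadratic forms -/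

section Expectation

variable {U Ω : Type*} [MeasurableSpace U] [MeasurableSpace Ω] {p : Measure U} {μ : Measure Ω}
  {K : ℕ} {X : Fin K → U → ℝ} {y : U → ℝ} {u : ℕ → Ω → U}

theorem integrable_empCorr_quadratic (hX : ∀ i, MemLp (X i) 4 p) (hy : MemLp y 4 p)
    (hu : ∀ n, HasLaw (u n) p μ) (Λ : Matrix (Fin K) (Fin K) ℝ) (N : ℕ) :
    Integrable (fun ω => empCorr X y (fun n => u n ω) N ⬝ᵥ
      ((Λ * Λᵀ) *ᵥ empCorr X y (fun n => u n ω) N)) μ := by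
  simp only [empCorr_quadratic_mul_transpose]
  exact integrable_finsetSum _ fun l _ => (memLp_empMean hu
    (memLp_mul (memLp_transformed hX Λ l) hy (by norm_num)) N).integrable_sq

theorem integral_empCorr_quadratic [IsFiniteMeasure p] (hX : ∀ i, MemLp (X i) 4 p)
    (hy : MemLp y 4 p) (h0 : ∀ i, ∫ v, X i v * y v ∂p = 0) (hu : ∀ n, HasLaw (u n) p μ)
    (hi : iIndepFun u μ) (Λ : Matrix (Fin K) (Fin K) ℝ) (N : ℕ) :
    ∫ ω, empCorr X y (fun n => u n ω) N ⬝ᵥ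
        ((Λ * Λᵀ) *ᵥ empCorr X y (fun n => u n ω) N) ∂μ
      = (∫ v, (∑ l, transformed X Λ l v ^ 2) * y v ^ 2 ∂p) / N := by
  have hprod : ∀ l, MemLp (fun v => transformed X Λ l v * y v) 2 p :=
    fun l => memLp_mul (memLp_transformed hX Λ l) hy (by norm_num)
  have hcentred : ∀ l, ∫ v, transformed X Λ l v * y v ∂p = 0 :=
    integral_transformed_mul_eq_zero (fun i => (hX i).mono_exponent (by norm_num))
      (hy.mono_exponent (by norm_num)) h0 Λ
  simp only [empCorr_quadratic_mul_transpose, Finset.sum_mul, ← mul_pow]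
  rw [integral_finsetSum _ fun l _ => (memLp_empMean hu (hprod l) N).integrable_sq,
    integral_finsetSum _ fun l _ => (hprod l).integrable_sq, Finset.sum_div]
  exact Finset.sum_congr rfl fun l _ => integral_empMean_sq hu hi (hprod l) (hcentred l) N

theorem integrable_pinv_empGram_quadratic (hX : ∀ i, MemLp (X i) 2 p) (hy : MemLp y 2 p)
    (hu : ∀ n, HasLaw (u n) p μ) (N : ℕ) :
    Integrable (fun ω => empCorr X y (fun n => u n ω) N ⬝ᵥ
      (pinv (empGram X (fun n => u n ω) N) *ᵥ empCorr X y (fun n => u n ω) N)) μ := by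
  have aemeasurable_empMean : ∀ {f g : U → ℝ}, MemLp f 2 p → MemLp g 2 p →
      AEMeasurable (fun ω => empMean (fun v => f v * g v) (fun n => u n ω) N) μ := fun hf hg =>
    (memLp_empMean hu (memLp_mul (q := 1) hf hg (by norm_num)) N).aemeasurable
  have hdom : Integrable (fun ω => empMean (fun v => y v ^ 2) (fun n => u n ω) N) μ :=
    memLp_one_iff_integrable.1
      (memLp_empMean hu (memLp_one_iff_integrable.2 hy.integrable_sq) N)
  refine hdom.mono' (aemeasurable_dotProduct_of_mulVec_eq
    (fun i j => aemeasurable_empMean (hX i) (hX j)) (fun i => aemeasurable_empMean (hX i) hy)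
    (fun ω => posSemidef_empGram X _ N)
    fun ω => empGram_mulVec_pinv_mulVec_empCorr X y _ N).aestronglyMeasurable
    (ae_of_all _ fun ω => ?_)
  rw [Real.norm_of_nonneg (pinv_empGram_quadratic_nonneg X y _ N)]
  exact pinv_empGram_quadratic_le X y _ N

open scoped Matrix.Norms.Operator in
theorem exists_abs_pinv_quadratic_sub_inv_quadratic_le (hG : IsUnit (gram p X).det)
    (h0 : ∀ i, ∫ v, X i v * y v ∂p = 0) :
    ∃ c : ℝ, 0 ≤ c ∧ ∀ (s : ℕ → U) (N : ℕ),
      |empCorr X y s N ⬝ᵥ (pinv (empGram X s N) *ᵥ empCorr X y s N)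
          - empCorr X y s N ⬝ᵥ ((gram p X)⁻¹ *ᵥ empCorr X y s N)|
        ≤ c * gramDev p (Fin.cons y X : Fin (K + 1) → U → ℝ) s N ^ 3 := by
  refine ⟨_, ?_, fun s N => abs_dotProduct_sub_inv_quadratic_le hG
    (empGram_mulVec_pinv_mulVec_empCorr X y s N)
    ((norm_le_sum_abs _).trans (gramDev_le_gramDev_cons X y s N))
    ((pi_norm_le_iff_of_nonneg (gramDev_nonneg _ s N)).2 fun i => ?_)
    (pinv_empGram_quadratic_nonneg X y s N) (integral_nonneg fun v => sq_nonneg (y v))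
    ((pinv_empGram_quadratic_le X y s N).trans (empMean_sq_le X y s N))⟩
  · positivity
  · simpa only [h0, sub_zero, Real.norm_eq_abs] using abs_empCorr_sub_le (p := p) X y s N i

theorem exists_integral_abs_pinv_quadratic_sub_le [IsProbabilityMeasure p]
    (hX : ∀ i, MemLp (X i) 6 p) (hy : MemLp y 6 p) (hG : IsUnit (gram p X).det)
    (h0 : ∀ i, ∫ v, X i v * y v ∂p = 0) (hu : ∀ n, HasLaw (u n) p μ) (hi : iIndepFun u μ) :
    ∃ C : ℝ, ∀ N : ℕ, N ≠ 0 →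
      ∫ ω, |empCorr X y (fun n => u n ω) N ⬝ᵥ
            (pinv (empGram X (fun n => u n ω) N) *ᵥ empCorr X y (fun n => u n ω) N)
          - empCorr X y (fun n => u n ω) N ⬝ᵥ
            ((gram p X)⁻¹ *ᵥ empCorr X y (fun n => u n ω) N)| ∂μ
        ≤ C * (N : ℝ) ^ (-(3 / 2) : ℝ) := by
  have := hi.isProbabilityMeasure
  set t : ℕ → Ω → ℝ := fun N ω =>
    gramDev p (Fin.cons y X : Fin (K + 1) → U → ℝ) (fun n => u n ω) N
  have hcons : ∀ i, MemLp ((Fin.cons y X : Fin (K + 1) → U → ℝ) i) 6 p := Fin.cases hy hX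
  have ht : ∀ N, Integrable (fun ω => t N ω ^ 3) μ := fun N => by
    simpa only [abs_of_nonneg (gramDev_nonneg _ _ _)] using
      integrable_abs_pow_three (memLp_gramDev hcons hu N)
  obtain ⟨c, hc0, hc⟩ := exists_abs_pinv_quadratic_sub_inv_quadratic_le hG h0
  obtain ⟨C, hC⟩ := exists_integral_gramDev_pow_three_le hcons hu hi
  refine ⟨c * C, fun N hN => ?_⟩
  calc _ ≤ ∫ ω, c * t N ω ^ 3 ∂μ :=
        integral_mono_of_nonneg (ae_of_all _ fun ω => abs_nonneg _) ((ht N).const_mul c)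
          (ae_of_all _ fun ω => hc _ N)
    _ = c * ∫ ω, t N ω ^ 3 ∂μ := integral_const_mul _ _
    _ ≤ c * (C * (N : ℝ) ^ (-(3 / 2) : ℝ)) := mul_le_mul_of_nonneg_left (hC N hN) hc0
    _ = c * C * (N : ℝ) ^ (-(3 / 2) : ℝ) := (mul_assoc _ _ _).symm

end Expectation

end StationarySystem

theorem proposition8
    {U : Type*} [MeasurableSpace U] (p : Measure U) [IsProbabilityMeasure p]
    {K : ℕ} (X : Fin K → U → ℝ) (y : U → ℝ)
    -- finite sixth moments of the readouts and of the target
    (hX : ∀ i, MemLp (X i) 6 p) (hy : MemLp y 6 p)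
    -- the target is not the zero vector
    (hy0 : 0 < ∫ v, y v ^ 2 ∂p)
    -- the Gram matrix has full rank, and `Λ` orthonormalizes the readouts
    (hG : IsUnit (StationarySystem.gram p X).det)
    (Λ : Matrix (Fin K) (Fin K) ℝ) (hΛ : Λᵀ * StationarySystem.gram p X * Λ = 1)
    -- the capacity vanishes
    (hC : StationarySystem.capacity p X y = 0)
    -- independent samples drawn from `p`
    {Ω : Type*} [MeasurableSpace Ω] (μ : Measure Ω) [IsProbabilityMeasure μ]
    (u : ℕ → Ω → U) (hu : ∀ n, Measurable (u n)) (hlaw : ∀ n, μ.map (u n) = p)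
    (hindep : iIndepFun u μ) :
    -- the empirical capacity has a finite expectation over datasets of any size
    (∀ N : ℕ, Integrable (fun ω => StationarySystem.empCapacity (∫ v, y v ^ 2 ∂p) X y
        (fun n => u n ω) N) μ) ∧
    -- its expectation is `Δ / N + O(N ^ (-3/2))`
    (fun N : ℕ => (∫ ω, StationarySystem.empCapacity (∫ v, y v ^ 2 ∂p) X y
        (fun n => u n ω) N ∂μ)
        - StationarySystem.Delta p (StationarySystem.transformed X Λ) y / (N : ℝ))
      =O[atTop] (fun N : ℕ => (N : ℝ) ^ (-(3 / 2) : ℝ)) ∧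
    -- bound on `Δ`
    StationarySystem.Delta p (StationarySystem.transformed X Λ) y
      ≤ Real.sqrt ((∫ v, (∑ i, StationarySystem.transformed X Λ i v ^ 2) ^ 2 ∂p)
          * ∫ v, y v ^ 4 ∂p) / ∫ v, y v ^ 2 ∂p := by
  have hX4 : ∀ i, MemLp (X i) 4 p := fun i => (hX i).mono_exponent (by norm_num)
  have hX2 : ∀ i, MemLp (X i) 2 p := fun i => (hX i).mono_exponent (by norm_num)
  have hy4 : MemLp y 4 p := hy.mono_exponent (by norm_num)
  have hy2 : MemLp y 2 p := hy.mono_exponent (by norm_num)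
  have hlaw' : ∀ n, HasLaw (u n) p μ := fun n => ⟨(hu n).aemeasurable, hlaw n⟩
  have h0 := StationarySystem.integral_mul_eq_zero_of_capacity_eq_zero hX2 hy2 hC
  have int_pinv := StationarySystem.integrable_pinv_empGram_quadratic hX2 hy2 hlaw'
  have int_inv := StationarySystem.integrable_empCorr_quadratic hX4 hy4 hlaw' Λ
  refine ⟨fun N => (int_pinv N).div_const _, ?_,
    StationarySystem.Delta_le (StationarySystem.memLp_transformed hX4 Λ) hy4⟩
  obtain ⟨C, hC'⟩ :=
    StationarySystem.exists_integral_abs_pinv_quadratic_sub_le hX hy hG h0 hlaw' hindep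
  rw [StationarySystem.inv_eq_mul_transpose hΛ] at hC'
  refine IsBigO.of_bound (C / ∫ v, y v ^ 2 ∂p) ?_
  filter_upwards [eventually_ne_atTop 0] with N hN
  simp only [StationarySystem.empCapacity, StationarySystem.Delta]
  rw [integral_div, div_right_comm,
    ← StationarySystem.integral_empCorr_quadratic hX4 hy4 h0 hlaw' hindep Λ N, ← sub_div,
    ← integral_sub (int_pinv N) (int_inv N), norm_div, Real.norm_of_nonneg hy0.le,
    Real.norm_of_nonneg (Real.rpow_nonneg N.cast_nonneg _), div_mul_eq_mul_div]
  exact div_le_div_of_nonneg_right (abs_integral_le_integral_abs.trans (hC' N hN)) hy0.le
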